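/- Let $B(t)$, $t\ge 0$, be a standard Brownian motion (with almost surely continuous paths) on a probability space $(\Omega,P)$, let $W_0(t)=B(t)$ and $W_n(t)=\int_0^t W_{n-1}(s)\,ds$ for $n\ge 1$, and define, for $n\ge 0$ and $t\in\mathbb R$, $$X_n(t)=e^{-(n+\frac12)t}\,W_n(e^t).$$ Then the following hold. 1. The processes $X_n$, $n\ge 0$, are jointly Gaussian: every finite collection of the variables $X_n(t)$ ($n\ge0$, $t\in\mathbb R$) has a joint Gaussian law. 2. They are jointly stationary: for every $h\in\mathbb R$ and all $(n_1,t_1),\dots,(n_m,t_m)$, the vectors $(X_{n_j}(t_j))_{j\le m}$ and $(X_{n_j}(t_j+h))_{j\le m}$ have the same law. 3. Almost surely, for all $n\ge1$ and $t\in\mathbb R$, $$X_n(t)=\int_{-\infty}^{\infty} f_n(t-s)\,X_{n-1}(s)\,ds,\qquad f_n(t)=e^{-(n+\frac12)t}\,1(t),$$ where $1(t)=1$ for $t\ge 0$ and $1(t)=0$ for $t<0$, and the integral converges absolutely. 4. There is a random measure $\zeta$ on $\mathbb R$, defined on $(\Omega,P)$, which is complex-valued, centered, jointly Gaussian and orthogonal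 with $E[\zeta(A)\overline{\zeta(A')}]=2\pi\,|A\cap A'|$ for all Borel sets $A,A'$ of finite Lebesgue measure, such that for all $n\ge0$ and $t\in\mathbb R$, almost surely, $$X_n(t)=\frac1{2\pi}\int_{-\infty}^{\infty}H_n(v)\,e^{ivt}\,\zeta(dv),\qquad H_n(v)=\prod_{k=0}^n\frac{1}{k+\frac12+iv},$$ where the integral of a function in $L^2(dv)$ against $\zeta$ is the mean-square limit of the integrals of approximating simple functions. -/

import Mathlib

open MeasureTheory ProbabilityTheory Filter Topology
open scoped ENNReal NNReal ComplexConjugate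

noncomputable section

namespace IntegratedBM

variable {Ω : Type*} {mΩ : MeasurableSpace Ω}

/-- The `n`-fold integrated process of `B`, built path by path:
`W 0 t = B t` and `W (n + 1) t = ∫₀ᵗ W n s ds`. -/
def W (B : ℝ≥0 → Ω → ℝ) : ℕ → ℝ≥0 → Ω → ℝ
  | 0, t, ω => B t ω
  | n + 1, t, ω => ∫ s in (0 : ℝ)..t, W B n s.toNNReal ω

/-- The time- and scale-changed process `X n t = e^{-(n + 1/2) t} W n (e^t)`, for all real `t`. -/
def X (B : ℝ≥0 → Ω → ℝ) (n : ℕ) (t : ℝ) (ω : Ω) : ℝ :=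
  Real.exp (-((n : ℝ) + 1 / 2) * t) * W B n (Real.exp t).toNNReal ω

/-- The convolution kernel `f n t = e^{-(n + 1/2) t} 1(t)`, where `1(t)` is the unit step. -/
def f (n : ℕ) (t : ℝ) : ℝ :=
  if 0 ≤ t then Real.exp (-((n : ℝ) + 1 / 2) * t) else 0

/-- The transfer function `H n v = ∏_{k=0}^n 1 / (k + 1/2 + i v)`. -/
def H (n : ℕ) (v : ℝ) : ℂ :=
  ∏ k ∈ Finset.range (n + 1), 1 / ((k : ℂ) + 1 / 2 + Complex.I * (v : ℂ))

/-- The members of a family `(Y i)` of real processes on `ℝ` are jointly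
(strictly) stationary: every finite collection of the variables `Y i t` has, jointly, the same law
as the collection of the `Y i (t + h)`, for every real shift `h`. -/
def JointlyStationary {ι : Type*} (Y : ι → ℝ → Ω → ℝ) (P : Measure Ω) : Prop :=
  ∀ (h : ℝ) (I : Finset (ι × ℝ)),
    IdentDistrib (fun ω (p : I) => Y p.1.1 p.1.2 ω) (fun ω (p : I) => Y p.1.1 (p.1.2 + h) ω) P P

/-- `ζ` is a centered complex Gaussian orthogonal random measure on `ℝ` with
`E[ζ(dv) conj ζ(dv')] = 2π δ_{v v'} dv`. Only the values of `ζ` on Borel sets of finite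
Lebesgue measure matter. Additivity of `ζ`, almost surely, and countable additivity in the
mean-square sense follow from the covariance formula. -/
structure IsSpectralNoise (ζ : Set ℝ → Ω → ℂ) (P : Measure Ω) : Prop where
  /-- All real and imaginary parts of the `ζ A` are jointly Gaussian. -/
  gaussian : IsGaussianProcess
    (fun (A : {A : Set ℝ // MeasurableSet A ∧ volume A < ∞}) ω => ζ A.1 ω) P
  memLp : ∀ A, MeasurableSet A → volume A < ∞ → MemLp (ζ A) 2 P
  mean_zero : ∀ A, MeasurableSet A → volume A < ∞ → ∫ ω, ζ A ω ∂P = 0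
  orthogonal : ∀ A A', MeasurableSet A → volume A < ∞ → MeasurableSet A' → volume A' < ∞ →
    ∫ ω, ζ A ω * conj (ζ A' ω) ∂P = ((2 * Real.pi * volume.real (A ∩ A') : ℝ) : ℂ)

/-- The integral `∑ c, c ζ(g = c)` of a simple function `g` against `ζ`. -/
def simpleIntegral (ζ : Set ℝ → Ω → ℂ) (g : SimpleFunc ℝ ℂ) (ω : Ω) : ℂ :=
  ∑ c ∈ g.range, c * ζ (g ⁻¹' {c}) ω

/-- `Y = ∫ φ(v) ζ(dv)`: the function `φ` is square-integrable and `Y` is the mean-square limit of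
the integrals of simple functions that converge to `φ` in `L²(dv)`. For a random measure `ζ` as in
`IsSpectralNoise` this determines `Y` almost surely. -/
def HasStochIntegral (ζ : Set ℝ → Ω → ℂ) (P : Measure Ω) (φ : ℝ → ℂ) (Y : Ω → ℂ) : Prop :=
  MemLp φ 2 volume ∧ MemLp Y 2 P ∧
    ∃ g : ℕ → SimpleFunc ℝ ℂ,
      (∀ k, MemLp (g k) 2 volume) ∧
      Tendsto (fun k => eLpNorm (fun v => φ v - g k v) 2 volume) atTop (𝓝 0) ∧
      Tendsto (fun k => eLpNorm (fun ω => Y ω - simpleIntegral ζ (g k) ω) 2 P) atTop (𝓝 0)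

end IntegratedBM

end

/-!
The random measure `ζ` comes first, and the other claims about laws are read off from it.

The covariance of the stationary Ornstein–Uhlenbeck process `X 0` is `e^{-|t - s|/2}`, which by
Fourier inversion equals `(2π)⁻¹ ∫ |H 0 v|² e^{iv(t - s)} dv` (`inner_waveLp_zero`). So the
assignment `H 0 v e^{ivt} ↦ 2π X 0 t` preserves inner products up to the factor `2π`. The functions
`v ↦ H 0 v e^{ivt}` span a dense subspace of `L²(ℝ)`, since a function orthogonal to all of them
has, after multiplication by the conjugate of `H 0`, a vanishing Fourier transform
(`span_waveLp_zero_dense`). Hence the assignment extends to an operator `J : L²(ℝ) → L²(P)` which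
is an isometry up to the factor `√(2π)` (`exists_clm_of_gram`). Its values are `L²` limits of linear
combinations of the `X 0 t`, thus centered and jointly Gaussian (`isGaussianProcess_clm`). The
random measure is `ζ(A) = J 1_A`, and by density of the simple functions `∫ φ dζ = J φ`
(`hasStochIntegral_noise`). No extra randomness is needed because `J` is defined on all of `L²(ℝ)`.

The substitution `u = e^s` in `W (n + 1) (e^t) = ∫_0^{e^t} W n u du` shows that along every
continuous path `X (n + 1)` is the convolution of `f (n + 1)` and `X n`
(`integrable_and_X_succ_eq`). On the frequency side this convolution multiplies by
`1 / (n + 1 + 1/2 + iv)`. Testing against indicators of events and using Fubini's theorem on both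
sides, one gets by induction that `J` sends `H n v e^{ivt}` to `2π X n t`
(`clm_waveLp_ae_eq`). Joint Gaussianity is then inherited from `J`, and stationarity holds because
the inner product of `H m v e^{ivs}` and `H n v e^{ivt}` depends on `s` and `t` through `t - s` only.

Fubini's theorem needs joint measurability, so this part is carried out for a version of `B` with
measurable values and continuous paths that agrees with `B` outside a null set.
-/

noncomputable section

namespace IntegratedBM

/-! ### Operators with a prescribed Gram matrix -/

section Gram

variable {E F ι : Type*} [NormedAddCommGroup E] [InnerProductSpace ℂ E]
  [NormedAddCommGroup F] [InnerProductSpace ℂ F] [CompleteSpace F]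

/-- If the Gram matrices of two families in Hilbert spaces are proportional, and the first family
spans a dense subspace, then a multiple of an isometry sends the first family to the second. -/
theorem exists_clm_of_gram (e : ι → E) (a : ι → F) (c : ℝ) (hc : 0 ≤ c)
    (h : ∀ i j, inner ℂ (a i) (a j) = c * inner ℂ (e i) (e j))
    (hd : (Submodule.span ℂ (Set.range e)).topologicalClosure = ⊤) :
    ∃ J : E →L[ℂ] F, (∀ i, J (e i) = a i) ∧
      ∀ x y, inner ℂ (J x) (J y) = c * inner ℂ x y := by
  set p := Finsupp.linearCombination ℂ a
  set q := Finsupp.linearCombination ℂ e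
  have hin : ∀ x y, inner ℂ (p x) (p y) = c * inner ℂ (q x) (q y) := by
    intro x y
    simp only [p, q, Finsupp.linearCombination_apply, Finsupp.sum, sum_inner, inner_sum,
      inner_smul_left, inner_smul_right, h, Finset.mul_sum]
    refine Finset.sum_congr rfl fun i _ => Finset.sum_congr rfl fun j _ => ?_
    ring
  have hdense : DenseRange q := by
    rw [← Submodule.dense_iff_topologicalClosure_eq_top,
      ← Finsupp.range_linearCombination] at hd
    exact hd
  have hn : ∀ x, ‖p x‖ ≤ √c * ‖q x‖ := by
    intro x
    have h1 := hin x x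
    rw [inner_self_eq_norm_sq_to_K, inner_self_eq_norm_sq_to_K] at h1
    have h2 : ‖p x‖ ^ 2 = c * ‖q x‖ ^ 2 := by
      apply Complex.ofReal_injective
      push_cast
      simpa using h1
    refine le_of_sq_le_sq ?_ (by positivity)
    rw [h2, mul_pow, Real.sq_sqrt hc]
  refine ⟨p.extendOfNorm q, fun i => ?_, ?_⟩
  · have := LinearMap.extendOfNorm_eq hdense ⟨_, hn⟩ (Finsupp.single i 1)
    simpa [p, q] using this
  · intro x y
    refine hdense.induction_on₂ (p := fun x y => inner ℂ (p.extendOfNorm q x)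
      (p.extendOfNorm q y) = c * inner ℂ x y) ?_ (fun x y => ?_) x y
    · exact isClosed_eq (by fun_prop) (by fun_prop)
    · simp only [LinearMap.extendOfNorm_eq hdense ⟨_, hn⟩]
      exact hin x y

end Gram

/-! ### Real parts and linear combinations in `L²` -/

section Lp

variable {Ω : Type*} {mΩ : MeasurableSpace Ω} {P : Measure Ω}

theorem coeFn_sum_smul {κ : Type*} (s : Finset κ) (c : κ → ℂ) (u : κ → Lp ℂ 2 P) :
    ⇑(∑ i ∈ s, c i • u i) =ᵐ[P] fun ω => ∑ i ∈ s, c i * u i ω := by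
  classical
  induction s using Finset.induction_on with
  | empty =>
    filter_upwards [Lp.coeFn_zero ℂ 2 P] with ω hω
    rw [Finset.sum_empty, hω]
    simp
  | insert a s ha ih =>
    rw [Finset.sum_insert ha]
    filter_upwards [ih, Lp.coeFn_add (c a • u a) (∑ i ∈ s, c i • u i),
      Lp.coeFn_smul (c a) (u a)] with ω h1 h2 h3
    rw [h2, Pi.add_apply, h1, h3, Finset.sum_insert ha]
    rfl

/-- The real part, as a map of `L²` spaces. -/
def reLp (P : Measure Ω) : Lp ℂ 2 P →L[ℝ] Lp ℝ 2 P := Complex.reCLM.compLpL 2 P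

theorem coeFn_reLp (u : Lp ℂ 2 P) : reLp P u =ᵐ[P] fun ω => (u ω).re :=
  Complex.reCLM.coeFn_compLpL u

theorem norm_sq_reLp (u : Lp ℂ 2 P) : ‖reLp P u‖ ^ 2 = ∫ ω, (u ω).re ^ 2 ∂P := by
  have h : inner ℝ (reLp P u) (reLp P u) = ‖reLp P u‖ ^ 2 := real_inner_self_eq_norm_sq _
  rw [← h, L2.inner_def]
  refine integral_congr_ae ?_
  filter_upwards [coeFn_reLp u] with ω hω
  rw [hω]; simp [sq]

theorem charFun_of_centered {u : Ω → ℝ} (hu : HasGaussianLaw u P) (h0 : ∫ ω, u ω ∂P = 0) :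
    ∫ ω, Complex.exp (u ω * Complex.I) ∂P = Complex.exp (-(∫ ω, u ω ^ 2 ∂P : ℝ) / 2) := by
  have h1 := hu.charFun_map_eq 1
  rw [charFun_apply, integral_map hu.aemeasurable (by fun_prop)] at h1
  simp only [RCLike.inner_apply, conj_trivial, mul_one, one_mul] at h1
  rw [h1, h0, variance_of_integral_eq_zero hu.aemeasurable h0]
  congr 1
  simp
  ring

end Lp

/-! ### Gaussian operators -/

section Gaussian

variable {Ω : Type*} {mΩ : MeasurableSpace Ω} {P : Measure Ω} [IsProbabilityMeasure P]

theorem integral_norm_le_norm_lp {G : Type*} [NormedAddCommGroup G] (u : Lp G 2 P) :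
    ∫ ω, ‖u ω‖ ∂P ≤ ‖u‖ := by
  have h := Lp.memLp u
  rw [Lp.norm_def, integral_norm_eq_lintegral_enorm h.1, ← eLpNorm_one_eq_lintegral_enorm]
  exact ENNReal.toReal_mono h.2.ne (eLpNorm_le_eLpNorm_of_exponent_le (by norm_num) h.1)

theorem integrable_cexp_mul_I {u : Ω → ℝ} (hu : AEStronglyMeasurable u P) :
    Integrable (fun ω => Complex.exp (u ω * Complex.I)) P := by
  refine Integrable.of_bound (C := 1)
    (Continuous.comp_aestronglyMeasurable (g := fun x : ℝ => Complex.exp (x * Complex.I))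
      (by fun_prop) hu) (ae_of_all _ fun ω => ?_)
  rw [Complex.norm_exp_ofReal_mul_I]

/-- The characteristic function at `1` is continuous in the random variable, for the `L²`
norm. -/
theorem continuous_integral_cexp_mul_I :
    Continuous fun u : Lp ℝ 2 P => ∫ ω, Complex.exp (u ω * Complex.I) ∂P := by
  refine LipschitzWith.continuous (K := 1) (LipschitzWith.of_dist_le_mul fun u w => ?_)
  have hu := (Lp.memLp u).1
  have hw := (Lp.memLp w).1
  rw [dist_eq_norm, dist_eq_norm, ← integral_sub (integrable_cexp_mul_I hu)
    (integrable_cexp_mul_I hw), NNReal.coe_one, one_mul]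
  refine le_trans ?_ (integral_norm_le_norm_lp (u - w))
  refine norm_integral_le_of_norm_le ((Lp.memLp (u - w)).integrable (by norm_num)).norm ?_
  filter_upwards [Lp.coeFn_sub u w] with ω hω
  rw [hω, Pi.sub_apply]
  have h1 : Complex.exp (u ω * Complex.I) - Complex.exp (w ω * Complex.I)
      = Complex.exp (w ω * Complex.I) * (Complex.exp (Complex.I * (u ω - w ω : ℝ)) - 1) := by
    rw [mul_sub, ← Complex.exp_add, mul_one]
    congr 2
    push_cast; ring
  rw [h1, norm_mul, Complex.norm_exp_ofReal_mul_I, one_mul]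
  exact Real.norm_exp_I_mul_ofReal_sub_one_le

variable {E ι : Type*} [NormedAddCommGroup E] [InnerProductSpace ℂ E]

variable (J : E →L[ℂ] Lp ℂ 2 P) {e : ι → E} {Z : ι → Ω → ℝ}

/-- If `J` sends a family with dense span to a centered Gaussian process, then `J g` is centered
and its real part has the Gaussian characteristic function at `1`, for every `g`. Both properties
are closed under `L²` limits, so that it suffices to check them on linear combinations. -/
theorem integral_re_eq_zero_and_charFun (hZ : IsGaussianProcess Z P)
    (hZ0 : ∀ i, ∫ ω, Z i ω ∂P = 0)
    (hJ : ∀ i, J (e i) =ᵐ[P] fun ω => (Z i ω : ℂ))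
    (hd : (Submodule.span ℂ (Set.range e)).topologicalClosure = ⊤) (g : E) :
    ∫ ω, J g ω ∂P = 0 ∧
    ∫ ω, Complex.exp ((J g ω).re * Complex.I) ∂P
      = Complex.exp (-(∫ ω, (J g ω).re ^ 2 ∂P : ℝ) / 2) := by
  rw [← Submodule.dense_iff_topologicalClosure_eq_top] at hd
  have hint : ∀ i, Integrable (Z i) P := fun i => (hZ.hasGaussianLaw_eval i).integrable
  constructor
  · -- the expectation is the inner product with the constant `1`, hence continuous in `g`
    have hc : IsClosed {g : E | inner ℂ (indicatorConstLp 2 (MeasurableSet.univ : MeasurableSet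
        (Set.univ : Set Ω)) (measure_ne_top P _) (1 : ℂ)) (J g) = 0} :=
      isClosed_eq (by fun_prop) (by fun_prop)
    have key : ∀ g, inner ℂ (indicatorConstLp 2 (MeasurableSet.univ : MeasurableSet
        (Set.univ : Set Ω)) (measure_ne_top P _) (1 : ℂ)) (J g) = ∫ ω, J g ω ∂P := by
      intro g
      rw [L2.inner_indicatorConstLp_one, setIntegral_univ]
    have := hd.induction (P := fun g => inner ℂ (indicatorConstLp 2 (MeasurableSet.univ :
      MeasurableSet (Set.univ : Set Ω)) (measure_ne_top P _) (1 : ℂ)) (J g) = 0) ?_ hc g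
    · rw [← key]; exact this
    · intro x hx
      induction hx using Submodule.span_induction with
      | mem x hx =>
        obtain ⟨i, rfl⟩ := hx
        rw [key, integral_congr_ae (hJ i), integral_complex_ofReal, hZ0]; simp
      | zero => simp
      | add x y _ _ hx hy => rw [map_add, inner_add_right, hx, hy, add_zero]
      | smul a x _ hx => rw [map_smul, inner_smul_right, hx, mul_zero]
  · have hcont : Continuous fun g : E => reLp P (J g) := by fun_prop
    have hc : IsClosed {g : E | ∫ ω, Complex.exp (reLp P (J g) ω * Complex.I) ∂P
        = Complex.exp (-(‖reLp P (J g)‖ ^ 2 : ℝ) / 2)} :=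
      isClosed_eq (continuous_integral_cexp_mul_I.comp hcont) (by fun_prop)
    have key : ∀ g, ∫ ω, Complex.exp (reLp P (J g) ω * Complex.I) ∂P =
        ∫ ω, Complex.exp ((J g ω).re * Complex.I) ∂P := by
      intro g
      refine integral_congr_ae ?_
      filter_upwards [coeFn_reLp (J g)] with ω hω
      rw [hω]
    have := hd.induction (P := fun g => ∫ ω, Complex.exp (reLp P (J g) ω * Complex.I) ∂P
        = Complex.exp (-(‖reLp P (J g)‖ ^ 2 : ℝ) / 2)) ?_ hc g
    · rw [key, norm_sq_reLp] at this; exact this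
    · intro x hx
      rw [key, norm_sq_reLp]
      obtain ⟨c, rfl⟩ := Finsupp.mem_span_range_iff_exists_finsupp.1 hx
      have hae : (fun ω => (J (c.sum fun i a => a • e i) ω).re) =ᵐ[P]
          fun ω => ∑ i ∈ c.support, (c i).re * Z i ω := by
        have h1 : J (c.sum fun i a => a • e i) = ∑ i ∈ c.support, c i • J (e i) := by
          simp [Finsupp.sum]
        rw [h1]
        have h2 : ∀ᵐ ω ∂P, ∀ i ∈ c.support, J (e i) ω = (Z i ω : ℂ) :=
          (ae_ball_iff (Finset.countable_toSet _)).2 fun i _ => hJ i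
        filter_upwards [coeFn_sum_smul c.support c (fun i => J (e i)), h2] with ω h3 h4
        rw [h3, Complex.re_sum]
        refine Finset.sum_congr rfl fun i hi => ?_
        rw [h4 i hi, Complex.re_mul_ofReal]
      have hG : HasGaussianLaw (fun ω => ∑ i ∈ c.support, (c i).re * Z i ω) P :=
        (hZ.smul fun i => (c i).re).hasGaussianLaw_fun_sum
      have h0 : ∫ ω, ∑ i ∈ c.support, (c i).re * Z i ω ∂P = 0 := by
        rw [integral_finsetSum _ fun i _ => (hint i).const_mul _]
        simp [integral_const_mul, hZ0]
      have h1 := charFun_of_centered hG h0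
      convert h1 using 1
      · refine integral_congr_ae ?_
        filter_upwards [hae] with ω hω
        rw [hω]
      · congr 4
        refine integral_congr_ae ?_
        filter_upwards [hae] with ω hω
        rw [hω]

/-- The values of an operator that sends a family with dense span to a centered Gaussian process
are jointly Gaussian: a real linear functional of finitely many values `J g` is again the real part
of a value of `J`, as `J` is complex linear. -/
theorem isGaussianProcess_clm (hZ : IsGaussianProcess Z P)
    (hZ0 : ∀ i, ∫ ω, Z i ω ∂P = 0)
    (hJ : ∀ i, J (e i) =ᵐ[P] fun ω => (Z i ω : ℂ))
    (hd : (Submodule.span ℂ (Set.range e)).topologicalClosure = ⊤) :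
    IsGaussianProcess (fun (g : E) ω => J g ω) P := by
  refine ⟨fun I => ?_⟩
  have hm : AEMeasurable (fun ω => I.restrict (fun g : E => J g ω)) P :=
    aemeasurable_pi_lambda _ fun g => (Lp.memLp (J g)).1.aemeasurable
  rw [hasGaussianLaw_iff_charFunDual_map_eq hm]
  intro L
  classical
  -- the real functional `z ↦ ℓ z` on `ℂ` is `z ↦ re ((ℓ 1 - i ℓ i) z)`
  let c : I → ℂ := fun i => L (Pi.single i 1) - Complex.I * L (Pi.single i Complex.I)
  have hL : ∀ x : I → ℂ, L x = (∑ i, c i * x i).re := by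
    intro x
    have h1 : x = ∑ i, ((x i).re • (Pi.single i 1 : I → ℂ) +
        (x i).im • (Pi.single i Complex.I : I → ℂ)) := by
      ext j
      simp [Finset.sum_apply, Pi.single_apply, Finset.sum_add_distrib]
    conv_lhs => rw [h1]
    simp only [map_sum, map_add, map_smul, Complex.re_sum, c]
    refine Finset.sum_congr rfl fun i _ => ?_
    simp
    ring
  have hae : (L ∘ fun ω => I.restrict (fun g : E => J g ω)) =ᵐ[P]
      fun ω => (J (∑ i, c i • (i : E)) ω).re := by
    have h1 : J (∑ i, c i • (i : E)) = ∑ i, c i • J i := by simp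
    rw [h1]
    filter_upwards [coeFn_sum_smul Finset.univ c (fun i : I => J i)] with ω hω
    rw [Function.comp_apply, hL, hω]
    rfl
  obtain ⟨h0, h1⟩ := integral_re_eq_zero_and_charFun J hZ hZ0 hJ hd (∑ i, c i • (i : E))
  set g := ∑ i, c i • (i : E)
  have hre : ∫ ω, (J g ω).re ∂P = 0 := by
    have := integral_re (𝕜 := ℂ) ((Lp.memLp (J g)).integrable (by norm_num))
    simp only [RCLike.re_to_complex] at this
    rw [this, h0]; rfl
  rw [integral_congr_ae hae, hre, variance_congr hae,
    variance_of_integral_eq_zero (by fun_prop) hre, charFunDual_apply,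
    integral_map hm (by fun_prop)]
  rw [show ∀ r : ℝ, Complex.exp (((0 : ℝ) : ℂ) * Complex.I - r / 2) = Complex.exp (-r / 2) from
    fun r => by congr 1; simp; ring]
  rw [← h1]
  refine integral_congr_ae ?_
  filter_upwards [hae] with ω hω
  rw [← hω]; rfl

end Gaussian

/-! ### The transfer functions in `L²(ℝ)` -/

section Spectral

open scoped FourierTransform SchwartzMap ContDiff

/-- The wave `v ↦ H n v * e^{ivt}`, whose integral against `ζ` is `2π X n t`. -/
def transferWave (n : ℕ) (t : ℝ) (v : ℝ) : ℂ := H n v * Complex.exp (Complex.I * v * t)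

theorem linear_factor_ne_zero (k : ℕ) (v : ℝ) :
    (k : ℂ) + 1 / 2 + Complex.I * (v : ℂ) ≠ 0 := by
  intro h
  have := congrArg Complex.re h
  simp at this
  have hk : (0 : ℝ) ≤ k := k.cast_nonneg
  linarith

theorem H_succ (n : ℕ) (v : ℝ) :
    H (n + 1) v = H n v * (1 / ((n + 1 : ℕ) + 1 / 2 + Complex.I * (v : ℂ))) := by
  simp only [H]
  rw [Finset.prod_range_succ]

theorem continuous_H (n : ℕ) : Continuous (H n) := by
  refine continuous_finsetProd _ fun k _ => ?_
  exact continuous_const.div (by fun_prop) (linear_factor_ne_zero k)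

theorem continuous_transferWave (n : ℕ) (t : ℝ) : Continuous (transferWave n t) :=
  (continuous_H n).mul (by fun_prop)

theorem norm_cexp_I_mul_mul (v t : ℝ) : ‖Complex.exp (Complex.I * v * t)‖ = 1 := by
  rw [show Complex.I * v * t = ((v * t : ℝ) : ℂ) * Complex.I by push_cast; ring,
    Complex.norm_exp_ofReal_mul_I]

theorem norm_transferWave (n : ℕ) (t v : ℝ) : ‖transferWave n t v‖ = ‖H n v‖ := by
  rw [transferWave, norm_mul, norm_cexp_I_mul_mul, mul_one]

theorem conj_H_zero_mul_H_zero (v : ℝ) : conj (H 0 v) * H 0 v = ((1 / 4 + v ^ 2)⁻¹ : ℝ) := by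
  have h1 := linear_factor_ne_zero 0 v
  have h2 : (1 / 2 + -(Complex.I * (v : ℂ))) ≠ 0 := by
    intro h
    have := congrArg Complex.re h
    simp at this
  have h3 : (1 / 4 + (v : ℂ) ^ 2) ≠ 0 := by
    have : (1 / 4 + v ^ 2 : ℝ) ≠ 0 := by positivity
    exact fun h => this (Complex.ofReal_injective (by push_cast; exact h))
  simp only [H, zero_add, Finset.prod_range_one, Nat.cast_zero] at h1 ⊢
  simp only [map_div₀, map_one, map_add, map_mul, Complex.conj_I, Complex.conj_ofReal, map_ofNat]
  push_cast
  rw [neg_mul]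
  field_simp
  ring_nf
  simp

theorem integrable_inv_quarter_add_sq : Integrable fun v : ℝ => (1 / 4 + v ^ 2)⁻¹ := by
  refine (integrable_inv_one_add_sq.const_mul 4).mono' (by fun_prop) (ae_of_all _ fun v => ?_)
  rw [Real.norm_of_nonneg (by positivity), ← div_eq_mul_inv, inv_eq_one_div,
    div_le_div_iff₀ (by positivity) (by positivity)]
  nlinarith [sq_nonneg v]

theorem memLp_H (n : ℕ) : MemLp (H n) 2 volume := by
  induction n with
  | zero =>
    rw [memLp_two_iff_integrable_sq_norm (continuous_H 0).aestronglyMeasurable]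
    refine integrable_inv_quarter_add_sq.congr (ae_of_all _ fun v => ?_)
    have := conj_H_zero_mul_H_zero v
    rw [Complex.conj_mul'] at this
    exact_mod_cast this.symm
  | succ n ih =>
    refine ih.of_le_mul (c := 1) (continuous_H _).aestronglyMeasurable (ae_of_all _ fun v => ?_)
    rw [H_succ, norm_mul, mul_comm]
    gcongr
    rw [norm_div, norm_one]
    refine div_le_one_of_le₀ ?_ (norm_nonneg _)
    refine le_trans ?_ (Complex.re_le_norm _)
    simp
    have hk : (0 : ℝ) ≤ n := n.cast_nonneg
    linarith

theorem memLp_transferWave (n : ℕ) (t : ℝ) : MemLp (transferWave n t) 2 volume :=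
  (memLp_H n).of_le (continuous_transferWave n t).aestronglyMeasurable
    (ae_of_all _ fun v => (norm_transferWave n t v).le)

/-- `transferWave n t` as an element of `L²(ℝ)`. -/
def waveLp (n : ℕ) (t : ℝ) : Lp ℂ 2 (volume : Measure ℝ) := (memLp_transferWave n t).toLp _

theorem coeFn_waveLp (n : ℕ) (t : ℝ) : waveLp n t =ᵐ[volume] transferWave n t :=
  (memLp_transferWave n t).coeFn_toLp

theorem inner_waveLp_eq_integral (m n : ℕ) (s t : ℝ) : inner ℂ (waveLp m s) (waveLp n t) =
    ∫ v : ℝ, conj (H m v) * H n v * Complex.exp (Complex.I * v * (t - s)) := by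
  rw [L2.inner_def]
  refine integral_congr_ae ?_
  filter_upwards [coeFn_waveLp m s, coeFn_waveLp n t] with v h1 h2
  rw [h1, h2, RCLike.inner_apply, transferWave, transferWave, map_mul, ← Complex.exp_conj,
    mul_sub, sub_eq_add_neg, Complex.exp_add]
  simp only [map_mul, Complex.conj_I, Complex.conj_ofReal, neg_mul]
  ring

/-- A common time shift multiplies both functions by `e^{ivh}`, which leaves their inner product
unchanged. -/
theorem inner_waveLp_shift (m n : ℕ) (s t h : ℝ) :
    inner ℂ (waveLp m (s + h)) (waveLp n (t + h)) = inner ℂ (waveLp m s) (waveLp n t) := by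
  rw [inner_waveLp_eq_integral, inner_waveLp_eq_integral]
  simp

/-- The Fourier transform of `e^{-|x|/2}` is `1 / (1/4 + a²)`. -/
theorem integrable_and_integral_exp_neg_abs (a : ℝ) :
    Integrable (fun x : ℝ => Complex.exp (-(a * x : ℝ) * Complex.I) *
      (Real.exp (-|x| / 2) : ℂ)) ∧
    ∫ x : ℝ, Complex.exp (-(a * x : ℝ) * Complex.I) * (Real.exp (-|x| / 2) : ℂ)
      = ((1 / 4 + a ^ 2)⁻¹ : ℝ) := by
  have hp : (-(1 / 2) - a * Complex.I : ℂ).re < 0 := by simp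
  have hm : 0 < ((1 / 2) - a * Complex.I : ℂ).re := by simp
  have e1 : Set.EqOn (fun x : ℝ => Complex.exp ((-(1 / 2) - a * Complex.I) * x))
      (fun x : ℝ => Complex.exp (-(a * x : ℝ) * Complex.I) * (Real.exp (-|x| / 2) : ℂ))
      (Set.Ioi 0) := by
    intro x hx
    simp only
    rw [abs_of_pos hx, Complex.ofReal_exp, ← Complex.exp_add]
    congr 1; push_cast; ring
  have e2 : Set.EqOn (fun x : ℝ => Complex.exp ((1 / 2 - a * Complex.I) * x))
      (fun x : ℝ => Complex.exp (-(a * x : ℝ) * Complex.I) * (Real.exp (-|x| / 2) : ℂ))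
      (Set.Iic 0) := by
    intro x hx
    simp only
    rw [abs_of_nonpos hx, Complex.ofReal_exp, ← Complex.exp_add]
    congr 1; push_cast; ring
  have i1 := (integrableOn_exp_mul_complex_Ioi hp 0).congr_fun e1 measurableSet_Ioi
  have i2 := (integrableOn_exp_mul_complex_Iic hm 0).congr_fun e2 measurableSet_Iic
  constructor
  · rw [← integrableOn_univ, ← Set.Iic_union_Ioi (a := (0 : ℝ))]
    exact i2.union i1
  · rw [← intervalIntegral.integral_Iic_add_Ioi i2 i1, ← setIntegral_congr_fun measurableSet_Ioi e1,
      ← setIntegral_congr_fun measurableSet_Iic e2, integral_exp_mul_complex_Ioi hp,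
      integral_exp_mul_complex_Iic hm]
    have h1 : (-(1 / 2) - a * Complex.I : ℂ) ≠ 0 := fun h => by
      rw [h] at hp; exact lt_irrefl _ hp
    have h2 : ((1 / 2) - a * Complex.I : ℂ) ≠ 0 := fun h => by
      rw [h] at hm; exact lt_irrefl _ hm
    push_cast
    simp only [mul_zero, Complex.exp_zero]
    have h4 : (1 / 4 + (a : ℂ) ^ 2) = -((-(1 / 2) - a * Complex.I) * ((1 / 2) - a * Complex.I)) := by
      ring_nf; simp
    have h5 : (-(1 / 2) - a * Complex.I : ℂ) - ((1 / 2) - a * Complex.I) = -1 := by ring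
    rw [h4]
    generalize (-(1 / 2) - a * Complex.I : ℂ) = p at *
    generalize ((1 / 2) - a * Complex.I : ℂ) = q at *
    calc 1 / q + -1 / p = (p - q) / (p * q) := by field_simp; ring
      _ = (-(p * q))⁻¹ := by rw [h5, inv_neg, neg_div, one_div]

/-- The Fourier transform of `1 / (1/4 + v²)` is `2π e^{-|t|/2}`, by Fourier inversion. -/
theorem integral_inv_quarter_add_sq_mul_cexp (t : ℝ) :
    ∫ v : ℝ, ((1 / 4 + v ^ 2)⁻¹ : ℝ) * Complex.exp (Complex.I * v * t)
      = 2 * Real.pi * Real.exp (-|t| / 2) := by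
  set g : ℝ → ℂ := fun x => (Real.exp (-|x| / 2) : ℂ)
  have hF : 𝓕 g = fun w : ℝ => (((1 / 4 + (2 * Real.pi * w) ^ 2)⁻¹ : ℝ) : ℂ) := by
    ext w
    rw [Real.fourier_real_eq_integral_exp_smul, ← (integrable_and_integral_exp_neg_abs _).2]
    refine integral_congr_ae (ae_of_all _ fun x => ?_)
    simp only [smul_eq_mul, g]
    congr 2
    push_cast; ring
  have hg : Integrable g := by
    refine (integrable_and_integral_exp_neg_abs 0).1.congr (ae_of_all _ fun x => ?_)
    simp [g]
  have hFi : Integrable (𝓕 g) := by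
    rw [hF]
    exact (integrable_inv_quarter_add_sq.comp_mul_left' (by positivity)).ofReal
  have h1 := hg.fourierInv_fourier_eq hFi (v := t)
    (Continuous.continuousAt (by simp only [g]; fun_prop))
  rw [Real.fourierInv_eq', hF] at h1
  have h2 := Measure.integral_comp_mul_left (fun v : ℝ => ((1 / 4 + v ^ 2)⁻¹ : ℝ) *
    Complex.exp (Complex.I * v * t)) (2 * Real.pi)
  have h3 : ∫ x : ℝ, (fun v : ℝ => ((1 / 4 + v ^ 2)⁻¹ : ℝ) *
      Complex.exp (Complex.I * v * t)) (2 * Real.pi * x) = g t := by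
    rw [← h1]
    refine integral_congr_ae (ae_of_all _ fun x => ?_)
    simp only [smul_eq_mul, RCLike.inner_apply, conj_trivial]
    rw [mul_comm]
    congr 2
    push_cast; ring
  rw [h3, abs_of_pos (by positivity), Complex.real_smul] at h2
  have h4 : (2 * Real.pi : ℂ) ≠ 0 := by
    simp [Real.pi_ne_zero]
  rw [show (Real.exp (-|t| / 2) : ℂ) = g t from rfl, h2]
  rw [← mul_assoc]
  push_cast
  rw [mul_inv_cancel₀ h4, one_mul]

theorem inner_waveLp_zero (s t : ℝ) :
    inner ℂ (waveLp 0 s) (waveLp 0 t) = 2 * Real.pi * Real.exp (-|t - s| / 2) := by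
  rw [inner_waveLp_eq_integral, ← integral_inv_quarter_add_sq_mul_cexp]
  refine integral_congr_ae (ae_of_all _ fun v => ?_)
  simp only [conj_H_zero_mul_H_zero]
  push_cast
  rfl

/-- An integrable function whose Fourier transform vanishes is zero almost everywhere: tested
against a smooth function with compact support, itself the Fourier transform of a Schwartz function,
it gives zero. -/
theorem ae_eq_zero_of_fourier_eq_zero {h : ℝ → ℂ} (hi : Integrable h) (h0 : 𝓕 h = 0) :
    h =ᵐ[volume] 0 := by
  refine ae_eq_zero_of_integral_contDiff_smul_eq_zero hi.locallyIntegrable fun χ hχ hc => ?_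
  have hχ' : ContDiff ℝ ∞ (fun x => (χ x : ℂ)) := Complex.ofRealCLM.contDiff.comp hχ
  have hc' : HasCompactSupport (fun x => (χ x : ℂ)) :=
    hc.comp_left (g := fun y : ℝ => (y : ℂ)) Complex.ofReal_zero
  set ψ : 𝓢(ℝ, ℂ) := hc'.toSchwartzMap hχ'
  have h1 : 𝓕 (𝓕⁻ ψ) = ψ := FourierTransform.fourier_fourierInv_eq ψ
  have h2 := VectorFourier.integral_fourierIntegral_smul_eq_flip (e := Real.fourierChar)
    (μ := volume) (ν := volume) (L := innerₗ ℝ) (f := (𝓕⁻ ψ : 𝓢(ℝ, ℂ))) (g := h)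
    Real.continuous_fourierChar continuous_inner (𝓕⁻ ψ).integrable hi
  have h3 : ∀ x, (𝓕 ((𝓕⁻ ψ : 𝓢(ℝ, ℂ)) : ℝ → ℂ)) x = (χ x : ℂ) := by
    intro x
    rw [← SchwartzMap.fourier_coe, h1]
    rfl
  rw [flip_innerₗ] at h2
  change ∫ ξ, (𝓕 ((𝓕⁻ ψ : 𝓢(ℝ, ℂ)) : ℝ → ℂ)) ξ • h ξ = ∫ x, (𝓕⁻ ψ) x • (𝓕 h) x at h2
  rw [h0] at h2
  simp only [h3] at h2
  simpa using h2

theorem span_waveLp_zero_dense :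
    (Submodule.span ℂ (Set.range (waveLp 0))).topologicalClosure = ⊤ := by
  rw [Submodule.topologicalClosure_eq_top_iff, Submodule.eq_bot_iff]
  intro u hu
  rw [Submodule.mem_orthogonal] at hu
  have hu' : ∀ t, inner ℂ (waveLp 0 t) u = 0 := fun t => hu _ (Submodule.subset_span ⟨t, rfl⟩)
  set h : ℝ → ℂ := fun v => conj (H 0 v) * u v
  have hi : Integrable h := by
    have h1 : MemLp (fun v => conj (H 0 v)) 2 volume := (memLp_H 0).star
    exact h1.integrable_mul (Lp.memLp u)
  have h0 : 𝓕 h = 0 := by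
    ext w
    rw [Real.fourier_real_eq_integral_exp_smul, Pi.zero_apply, ← hu' (2 * Real.pi * w),
      L2.inner_def]
    refine integral_congr_ae ?_
    filter_upwards [coeFn_waveLp 0 (2 * Real.pi * w)] with v hv
    rw [hv, RCLike.inner_apply, transferWave, map_mul, ← Complex.exp_conj]
    simp only [map_mul, Complex.conj_I, Complex.conj_ofReal, h, smul_eq_mul]
    rw [show ((-2 * Real.pi * v * w : ℝ) : ℂ) * Complex.I
      = -Complex.I * v * (2 * Real.pi * w : ℝ) by push_cast; ring]
    ring
  have h1 := ae_eq_zero_of_fourier_eq_zero hi h0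
  rw [Lp.eq_zero_iff_ae_eq_zero]
  filter_upwards [h1] with v hv
  have h2 : H 0 v ≠ 0 := by
    rw [H, Finset.prod_ne_zero_iff]
    exact fun k _ => one_div_ne_zero (linear_factor_ne_zero k v)
  simpa [h, h2] using hv

/-- The convolution with `f (n + 1)` acts on waves of frequency `v` as the multiplication by
`1 / (n + 1 + 1 / 2 + i v)`. -/
theorem integral_f_mul_transferWave (n : ℕ) (t v : ℝ) :
    ∫ s, (f (n + 1) (t - s) : ℂ) * transferWave n s v = transferWave (n + 1) t v := by
  set a : ℂ := ((n + 1 : ℕ) : ℂ) + 1 / 2 + Complex.I * v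
  have ha : 0 < a.re := by
    simp [a]
    have hk : (0 : ℝ) ≤ n := n.cast_nonneg
    linarith
  have ha0 : a ≠ 0 := linear_factor_ne_zero (n + 1) v
  have h1 : ∀ s : ℝ, (f (n + 1) (t - s) : ℂ) * transferWave n s v =
      (Set.Iic t).indicator (fun s : ℝ => H n v * Complex.exp (-(((n + 1 : ℕ) : ℂ) + 1 / 2) * t)
        * Complex.exp (a * s)) s := by
    intro s
    by_cases hs : s ≤ t
    · rw [Set.indicator_of_mem (by exact hs), f, if_pos (by linarith), transferWave,
        Complex.ofReal_exp]
      have : Complex.exp ((-(((n + 1 : ℕ) : ℝ) + 1 / 2) * (t - s) : ℝ)) *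
          Complex.exp (Complex.I * v * s) =
          Complex.exp (-(((n + 1 : ℕ) : ℂ) + 1 / 2) * t) * Complex.exp (a * s) := by
        rw [← Complex.exp_add, ← Complex.exp_add]
        congr 1
        simp only [a]
        push_cast
        ring
      rw [mul_left_comm, this]
      ring
    · rw [Set.indicator_of_notMem (by exact hs), f, if_neg (by linarith)]
      simp
  simp only [h1]
  rw [integral_indicator measurableSet_Iic, integral_const_mul, integral_exp_mul_complex_Iic ha,
    transferWave, H_succ, mul_assoc, mul_div_assoc', ← Complex.exp_add]
  rw [mul_assoc, one_div_mul_eq_div]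
  congr 3
  simp only [a]
  ring

theorem integrable_f (n : ℕ) (t : ℝ) : Integrable (fun s => f n (t - s)) := by
  have h1 : (fun s => f n (t - s)) =
      (Set.Iic t).indicator (fun s : ℝ => Real.exp (-((n : ℝ) + 1 / 2) * t)
        * Real.exp (((n : ℝ) + 1 / 2) * s)) := by
    ext s
    by_cases hs : s ≤ t
    · rw [Set.indicator_of_mem (by exact hs), f, if_pos (by linarith), ← Real.exp_add]
      congr 1; ring
    · rw [Set.indicator_of_notMem (by exact hs), f, if_neg (by linarith)]
  rw [h1, integrable_indicator_iff measurableSet_Iic]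
  exact (integrableOn_exp_mul_Iic (by positivity) t).const_mul _

end Spectral

/-! ### The paths of the iterated integrals -/

section Paths

variable {Ω : Type*} {mΩ : MeasurableSpace Ω} {B B' : ℝ≥0 → Ω → ℝ}

theorem continuous_W {ω : Ω} (hc : Continuous fun t => B t ω) (n : ℕ) :
    Continuous fun t => W B n t ω := by
  induction n with
  | zero => exact hc
  | succ n ih =>
    have hg : Continuous fun s : ℝ => W B n s.toNNReal ω := ih.comp continuous_real_toNNReal
    exact (intervalIntegral.continuous_primitive (fun a b => hg.intervalIntegrable a b) 0).comp
      NNReal.continuous_coe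

theorem measurable_W (hm : ∀ t, Measurable (B t)) (hc : ∀ ω, Continuous fun t => B t ω) (n : ℕ)
    (t : ℝ≥0) : Measurable (W B n t) := by
  induction n generalizing t with
  | zero => exact hm t
  | succ n ih =>
    have h1 : Measurable (Function.uncurry (W B n)) :=
      measurable_uncurry_of_continuous_of_measurable (fun ω => continuous_W (hc ω) n) ih
    have h2 : Measurable (Function.uncurry fun (s : ℝ) ω => W B n s.toNNReal ω) :=
      h1.comp ((measurable_real_toNNReal.comp measurable_fst).prodMk measurable_snd)
    have h3 : W B (n + 1) t = fun ω => ∫ s in Set.Ioc (0 : ℝ) t, W B n s.toNNReal ω := by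
      ext ω
      exact intervalIntegral.integral_of_le t.2
    rw [h3]
    exact (h2.stronglyMeasurable.integral_prod_left
      (μ := volume.restrict (Set.Ioc (0 : ℝ) t))).measurable

theorem measurable_uncurry_X (hm : ∀ t, Measurable (B t)) (hc : ∀ ω, Continuous fun t => B t ω)
    (n : ℕ) : Measurable (Function.uncurry (X B n)) := by
  have h1 : Measurable (Function.uncurry (W B n)) :=
    measurable_uncurry_of_continuous_of_measurable (fun ω => continuous_W (hc ω) n)
      (measurable_W hm hc n)
  have h2 : Measurable (fun p : ℝ × Ω => Function.uncurry (W B n) ((Real.exp p.1).toNNReal, p.2)) :=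
    h1.comp (by fun_prop)
  have h3 : Measurable (fun p : ℝ × Ω => Real.exp (-((n : ℝ) + 1 / 2) * p.1)) := by fun_prop
  exact h3.mul h2

theorem W_congr {ω : Ω} (h : ∀ t, B t ω = B' t ω) (n : ℕ) (t : ℝ≥0) :
    W B n t ω = W B' n t ω := by
  induction n generalizing t with
  | zero => exact h t
  | succ n ih => simp only [W, ih]

theorem X_congr {ω : Ω} (h : ∀ t, B t ω = B' t ω) (n : ℕ) (t : ℝ) : X B n t ω = X B' n t ω := by
  rw [X, X, W_congr h]

/-- For a continuous path, `X (n + 1)` is the convolution of `f (n + 1)` and `X n`. -/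
theorem integrable_and_X_succ_eq {ω : Ω} (hc : Continuous fun t => B t ω) (n : ℕ) (t : ℝ) :
    Integrable (fun s => f (n + 1) (t - s) * X B n s ω) ∧
      X B (n + 1) t ω = ∫ s, f (n + 1) (t - s) * X B n s ω := by
  set g : ℝ → ℝ := fun u => W B n u.toNNReal ω
  have hg : Continuous g := (continuous_W hc n).comp continuous_real_toNNReal
  set c := Real.exp (-(((n + 1 : ℕ) : ℝ) + 1 / 2) * t)
  have h1 : (fun s => f (n + 1) (t - s) * X B n s ω) =
      (Set.Iic t).indicator fun s => c * (|Real.exp s| • g (Real.exp s)) := by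
    ext s
    by_cases hs : s ≤ t
    · rw [Set.indicator_of_mem (by exact hs), f, if_pos (by linarith), X, abs_of_pos
        (Real.exp_pos s), smul_eq_mul, ← mul_assoc, ← mul_assoc, ← Real.exp_add, ← Real.exp_add]
      congr 2
      push_cast
      ring
    · rw [Set.indicator_of_notMem (by exact hs), f, if_neg (by linarith), zero_mul]
  have himg : Real.exp '' Set.Iic t = Set.Ioc 0 (Real.exp t) := by
    ext u
    constructor
    · rintro ⟨s, hs, rfl⟩
      exact ⟨Real.exp_pos s, Real.exp_le_exp.2 hs⟩
    · rintro ⟨h0, hu⟩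
      exact ⟨Real.log u, (Real.log_le_iff_le_exp h0).2 hu, Real.exp_log h0⟩
  have hder : ∀ x ∈ Set.Iic t, HasDerivWithinAt Real.exp (Real.exp x) (Set.Iic t) x :=
    fun x _ => (Real.hasDerivAt_exp x).hasDerivWithinAt
  have hinj : Set.InjOn Real.exp (Set.Iic t) := Real.exp_injective.injOn
  have hI : IntegrableOn g (Set.Ioc 0 (Real.exp t)) :=
    (hg.integrableOn_Icc (a := 0) (b := Real.exp t)).mono_set Set.Ioc_subset_Icc_self
  rw [h1]
  constructor
  · rw [integrable_indicator_iff measurableSet_Iic]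
    refine Integrable.const_mul ?_ c
    rw [← himg] at hI
    exact (integrableOn_image_iff_integrableOn_abs_deriv_smul measurableSet_Iic hder hinj g).1 hI
  · rw [integral_indicator measurableSet_Iic, integral_const_mul,
      ← integral_image_eq_integral_abs_deriv_smul measurableSet_Iic hder hinj, himg, X, W,
      Real.coe_toNNReal _ (Real.exp_pos t).le, intervalIntegral.integral_of_le (Real.exp_pos t).le]

variable {P : Measure Ω}

/-- A process with almost surely continuous paths coincides, outside a null set, with a process
with measurable values and continuous paths. -/
theorem exists_measurable_continuous_version (hB : ∀ t, AEMeasurable (B t) P)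
    (hc : ∀ᵐ ω ∂P, Continuous fun t => B t ω) :
    ∃ B' : ℝ≥0 → Ω → ℝ, (∀ t, Measurable (B' t)) ∧ (∀ ω, Continuous fun t => B' t ω) ∧
      ∀ᵐ ω ∂P, ∀ t, B t ω = B' t ω := by
  classical
  let d := TopologicalSpace.denseSeq ℝ≥0
  have h1 : ∀ᵐ ω ∂P, Continuous (fun t => B t ω) ∧ ∀ k, B (d k) ω = (hB (d k)).mk _ ω :=
    hc.and (ae_all_iff.2 fun k => (hB (d k)).ae_eq_mk)
  obtain ⟨S, hSm, hS, hSP⟩ : ∃ S : Set Ω, MeasurableSet S ∧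
      (∀ ω ∈ S, Continuous (fun t => B t ω) ∧ ∀ k, B (d k) ω = (hB (d k)).mk _ ω) ∧
      ∀ᵐ ω ∂P, ω ∈ S := by
    obtain ⟨S, hsub, hm, h0⟩ := exists_measurable_superset_of_null (ae_iff.1 h1)
    refine ⟨Sᶜ, hm.compl, fun ω hω => ?_, compl_mem_ae_iff.2 h0⟩
    by_contra hcon
    exact hω (hsub hcon)
  let B' : ℝ≥0 → Ω → ℝ := fun t => S.indicator (B t)
  have hcont : ∀ ω, Continuous fun t => B' t ω := by
    intro ω
    by_cases hω : ω ∈ S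
    · simpa [B', hω] using (hS ω hω).1
    · simpa [B', hω] using continuous_const
  have hd : ∀ k, Measurable (B' (d k)) := by
    intro k
    have : B' (d k) = S.indicator ((hB (d k)).mk _) :=
      Set.indicator_congr fun ω hω => (hS ω hω).2 k
    rw [this]
    exact (hB (d k)).measurable_mk.indicator hSm
  refine ⟨B', fun t => ?_, hcont, ?_⟩
  · have ht : t ∈ closure (Set.range d) := TopologicalSpace.denseRange_denseSeq ℝ≥0 t
    obtain ⟨x, hx, hxt⟩ := mem_closure_iff_seq_limit.1 ht
    refine measurable_of_tendsto_metrizable (f := fun j => B' (x j)) (fun j => ?_) ?_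
    · obtain ⟨k, hk⟩ := hx j
      rw [← hk]
      exact hd k
    · exact tendsto_pi_nhds.2 fun ω => ((hcont ω).tendsto t).comp hxt
  · filter_upwards [hSP] with ω hω t
    simp [B', hω]

end Paths

/-! ### Equality in law of Gaussian processes -/

section Stationary

variable {Ω T : Type*} {mΩ : MeasurableSpace Ω} {P : Measure Ω}

/-- Gaussian processes with the same means and covariances have the same finite-dimensional
laws. -/
theorem identDistrib_restrict_of_covariance_eq {Y Y' : T → Ω → ℝ} (hY : IsGaussianProcess Y P)
    (hY' : IsGaussianProcess Y' P) (h0 : ∀ i, ∫ ω, Y i ω ∂P = ∫ ω, Y' i ω ∂P)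
    (hcov : ∀ i j, cov[Y i, Y j; P] = cov[Y' i, Y' j; P]) (I : Finset T) :
    IdentDistrib (fun ω => I.restrict (Y · ω)) (fun ω => I.restrict (Y' · ω)) P P := by
  have := hY.isProbabilityMeasure
  have hm := aemeasurable_pi_lambda (fun ω => I.restrict (Y · ω)) fun i => hY.aemeasurable i.1
  have hm' := aemeasurable_pi_lambda (fun ω => I.restrict (Y' · ω)) fun i => hY'.aemeasurable i.1
  refine ⟨hm, hm', ?_⟩
  have := Measure.isProbabilityMeasure_map hm
  have := Measure.isProbabilityMeasure_map hm'
  refine Measure.ext_of_charFunDual (funext fun L => ?_)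
  classical
  obtain ⟨a, hL⟩ : ∃ a : I → ℝ, ∀ x : I → ℝ, L x = ∑ i, a i * x i := by
    refine ⟨fun i => L (Pi.single i 1), fun x => ?_⟩
    conv_lhs => rw [pi_eq_sum_univ' x]
    simp only [map_sum, map_smul, smul_eq_mul]
    refine Finset.sum_congr rfl fun i _ => ?_
    rw [mul_comm]
  rw [(hY.hasGaussianLaw I).charFunDual_map_eq_fun, (hY'.hasGaussianLaw I).charFunDual_map_eq_fun]
  have hi : ∀ i : I, MemLp (fun ω => a i * Y i ω) 2 P :=
    fun i => (hY.hasGaussianLaw_eval i.1).memLp_two.const_mul _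
  have hi' : ∀ i : I, MemLp (fun ω => a i * Y' i ω) 2 P :=
    fun i => (hY'.hasGaussianLaw_eval i.1).memLp_two.const_mul _
  simp only [hL, Finset.restrict]
  rw [integral_finsetSum _ fun i _ => (hi i).integrable (by norm_num),
    integral_finsetSum _ fun i _ => (hi' i).integrable (by norm_num),
    variance_fun_sum hi, variance_fun_sum hi']
  simp only [integral_const_mul, h0, covariance_const_mul_left, covariance_const_mul_right]
  have hcov' : ∀ i j : T, cov[fun ω => Y i ω, fun ω => Y j ω; P]
      = cov[fun ω => Y' i ω, fun ω => Y' j ω; P] := hcov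
  simp only [hcov']

end Stationary

/-! ### The random measure of an operator -/

section Noise

variable {Ω : Type*} {mΩ : MeasurableSpace Ω} {P : Measure Ω}

/-- The indicator of `A`, as an element of `L²(ℝ)`; it is zero unless `A` is a Borel set of
finite Lebesgue measure. -/
def indLp (A : Set ℝ) : Lp ℂ 2 (volume : Measure ℝ) :=
  open Classical in
  if h : MeasurableSet A ∧ volume A < ∞ then indicatorConstLp 2 h.1 h.2.ne 1 else 0

theorem indLp_of_finite {A : Set ℝ} (hA : MeasurableSet A) (h : volume A < ∞) :
    indLp A = indicatorConstLp 2 hA h.ne 1 := dif_pos ⟨hA, h⟩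

/-- The random measure `A ↦ J 1_A` of an operator `J : L²(ℝ) → L²(P)`. -/
def noise (J : Lp ℂ 2 (volume : Measure ℝ) →L[ℂ] Lp ℂ 2 P) (A : Set ℝ) : Ω → ℂ := J (indLp A)

variable (J : Lp ℂ 2 (volume : Measure ℝ) →L[ℂ] Lp ℂ 2 P)

/-- The covariance formula for `noise J` is the inner product formula for `J`, applied to
indicators. -/
theorem isSpectralNoise_noise [IsProbabilityMeasure P]
    (hJ : ∀ x y, inner ℂ (J x) (J y) = ((2 * Real.pi : ℝ) : ℂ) * inner ℂ x y)
    (hG : IsGaussianProcess (fun (g : Lp ℂ 2 (volume : Measure ℝ)) ω => J g ω) P)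
    (h0 : ∀ g, ∫ ω, J g ω ∂P = 0) : IsSpectralNoise (noise J) P where
  gaussian := hG.comp_right fun A : {A : Set ℝ // MeasurableSet A ∧ volume A < ∞} => indLp A.1
  memLp A _ _ := Lp.memLp _
  mean_zero A _ _ := h0 _
  orthogonal A A' hA hA1 hA' hA1' := by
    have h1 := hJ (indLp A') (indLp A)
    rw [indLp_of_finite hA hA1, indLp_of_finite hA' hA1',
      L2.inner_indicatorConstLp_indicatorConstLp] at h1
    rw [L2.inner_def] at h1
    simp only [RCLike.inner_apply] at h1
    simp only [noise, indLp_of_finite hA hA1, indLp_of_finite hA' hA1']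
    rw [h1, Set.inter_comm]
    simp

/-- The level set `g⁻¹{0}` has infinite measure, so that its `indLp` is `0`; this does not matter,
as its coefficient is `0`. -/
theorem toLp_simpleFunc_eq_sum (g : SimpleFunc ℝ ℂ) (hg : MemLp g 2 volume) :
    hg.toLp g = ∑ c ∈ g.range, c • indLp (g ⁻¹' {c}) := by
  refine Lp.ext ?_
  have h1 : ∀ᵐ v, ∀ c ∈ g.range, c * indLp (g ⁻¹' {c}) v =
      c * (g ⁻¹' {c}).indicator (fun _ => (1 : ℂ)) v := by
    refine (ae_ball_iff (Finset.countable_toSet _)).2 fun c _ => ?_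
    by_cases hc : c = 0
    · simp [hc]
    · have hfin := SimpleFunc.measure_preimage_lt_top_of_memLp (by norm_num) (by norm_num) g hg c hc
      rw [indLp_of_finite (g.measurableSet_fiber c) hfin]
      filter_upwards [indicatorConstLp_coeFn (p := 2) (hs := g.measurableSet_fiber c)
        (hμs := hfin.ne) (c := (1 : ℂ))] with v hv
      rw [hv]
  filter_upwards [hg.coeFn_toLp, coeFn_sum_smul g.range id fun c => indLp (g ⁻¹' {c}), h1]
    with v h2 h3 h4
  simp only [id] at h3
  rw [h2, h3, Finset.sum_congr rfl h4, Finset.sum_eq_single (g v)]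
  · simp
  · intro c _ hc
    rw [Set.indicator_of_notMem (by simpa using hc.symm), mul_zero]
  · intro h
    exact absurd (SimpleFunc.mem_range_self g v) h

theorem clm_toLp_simpleFunc (g : SimpleFunc ℝ ℂ) (hg : MemLp g 2 volume) :
    J (hg.toLp g) =ᵐ[P] simpleIntegral (noise J) g := by
  rw [toLp_simpleFunc_eq_sum, map_sum]
  simp only [map_smul]
  exact coeFn_sum_smul g.range id fun c => J (indLp (g ⁻¹' {c}))

/-- Integration against `noise J` is the operator `J`. -/
theorem hasStochIntegral_noise {φ : ℝ → ℂ} (hφ : MemLp φ 2 volume) :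
    HasStochIntegral (noise J) P φ (J (hφ.toLp φ)) := by
  refine ⟨hφ, Lp.memLp _, ?_⟩
  have hex : ∀ k : ℕ, ∃ g : SimpleFunc ℝ ℂ,
      eLpNorm (φ - ⇑g) 2 volume < ((k : ℝ≥0∞) + 1)⁻¹ ∧ MemLp g 2 volume := fun k =>
    hφ.exists_simpleFunc_eLpNorm_sub_lt (by norm_num)
      (ENNReal.inv_ne_zero.2 (by simp))
  choose g hg hgm using hex
  have hlim : Tendsto (fun k => eLpNorm (fun v => φ v - g k v) 2 volume) atTop (𝓝 0) := by
    refine tendsto_of_tendsto_of_tendsto_of_le_of_le tendsto_const_nhds ?_ (fun _ => zero_le)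
      fun k => (hg k).le
    have h1 := ENNReal.tendsto_inv_nat_nhds_zero.comp (tendsto_add_atTop_nat 1)
    refine h1.congr fun k => ?_
    simp
  refine ⟨g, hgm, hlim, ?_⟩
  have hle : ∀ k, eLpNorm (fun ω => J (hφ.toLp φ) ω - simpleIntegral (noise J) (g k) ω) 2 P ≤
      ‖J‖ₑ * eLpNorm (fun v => φ v - g k v) 2 volume := by
    intro k
    have h1 : eLpNorm (fun ω => J (hφ.toLp φ) ω - simpleIntegral (noise J) (g k) ω) 2 P
        = ‖J (hφ.toLp φ - (hgm k).toLp (g k))‖ₑ := by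
      rw [Lp.enorm_def, map_sub]
      refine eLpNorm_congr_ae ?_
      filter_upwards [clm_toLp_simpleFunc J (g k) (hgm k),
        Lp.coeFn_sub (J (hφ.toLp φ)) (J ((hgm k).toLp (g k)))] with ω h2 h3
      rw [h3, Pi.sub_apply, h2]
    have h2 : ‖hφ.toLp φ - (hgm k).toLp (g k)‖ₑ = eLpNorm (fun v => φ v - g k v) 2 volume := by
      rw [← MemLp.toLp_sub, Lp.enorm_toLp]
      rfl
    rw [h1, ← h2]
    exact J.le_opENorm _
  refine tendsto_of_tendsto_of_tendsto_of_le_of_le tendsto_const_nhds ?_ (fun _ => zero_le) hle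
  simpa using ENNReal.Tendsto.const_mul hlim (Or.inr enorm_ne_top)

end Noise

/-! ### The spectral representation of the processes -/

section Representation

variable {Ω : Type*} {mΩ : MeasurableSpace Ω} {P : Measure Ω} {B : ℝ≥0 → Ω → ℝ}

theorem covariance_X_zero (hB : IsPreBrownianReal B P) (s t : ℝ) :
    cov[X B 0 s, X B 0 t; P] = Real.exp (-|t - s| / 2) := by
  have h : cov[X B 0 s, X B 0 t; P] = Real.exp (-((0 : ℕ) + 1 / 2) * s) *
      (Real.exp (-((0 : ℕ) + 1 / 2) * t) * (min (Real.exp s) (Real.exp t))) := by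
    have h1 := hB.covariance_fun_eval (Real.exp s).toNNReal (Real.exp t).toNNReal
    rw [NNReal.coe_min, Real.coe_toNNReal _ (Real.exp_pos s).le,
      Real.coe_toNNReal _ (Real.exp_pos t).le] at h1
    rw [← h1, ← covariance_const_mul_right, ← covariance_const_mul_left]
    rfl
  rw [h]
  rcases le_total s t with hst | hst
  · rw [min_eq_left (Real.exp_le_exp.2 hst), abs_of_nonneg (by linarith), ← Real.exp_add,
      ← Real.exp_add]
    congr 1
    push_cast
    ring
  · rw [min_eq_right (Real.exp_le_exp.2 hst), abs_of_nonpos (by linarith), ← Real.exp_add,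
      ← Real.exp_add]
    congr 1
    push_cast
    ring

theorem integral_X_zero (hB : IsPreBrownianReal B P) (t : ℝ) : ∫ ω, X B 0 t ω ∂P = 0 := by
  have h : ∫ ω, X B 0 t ω ∂P =
      ∫ ω, Real.exp (-((0 : ℕ) + 1 / 2) * t) * B (Real.exp t).toNNReal ω ∂P := rfl
  rw [h, integral_const_mul, hB.integral_eval, mul_zero]

theorem isGaussianProcess_X_zero (hB : IsPreBrownianReal B P) :
    IsGaussianProcess (fun t ω => 2 * Real.pi * X B 0 t ω) P := by
  have h := (hB.isGaussianProcess.comp_right fun t : ℝ => (Real.exp t).toNNReal).smul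
    fun t => 2 * Real.pi * Real.exp (-((0 : ℕ) + 1 / 2) * t)
  exact h.congr fun t => ae_of_all _ fun ω => mul_assoc _ _ _

theorem norm_waveLp (n : ℕ) (t : ℝ) : ‖waveLp n t‖ = ‖waveLp n 0‖ := by
  have h := inner_waveLp_shift n n 0 0 t
  rw [zero_add, inner_self_eq_norm_sq_to_K, inner_self_eq_norm_sq_to_K] at h
  have h2 : ‖waveLp n t‖ ^ 2 = ‖waveLp n 0‖ ^ 2 := by
    apply Complex.ofReal_injective
    push_cast
    simpa using h
  exact (sq_eq_sq₀ (norm_nonneg _) (norm_nonneg _)).1 h2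

theorem inner_waveLp_right (G : Lp ℂ 2 (volume : Measure ℝ)) (n : ℕ) (t : ℝ) :
    inner ℂ G (waveLp n t) = ∫ v, conj (G v) * transferWave n t v := by
  rw [L2.inner_def]
  refine integral_congr_ae ?_
  filter_upwards [coeFn_waveLp n t] with v hv
  rw [hv, RCLike.inner_apply, mul_comm]

/-- In the weak sense, `waveLp (n + 1) t` is the convolution of `f (n + 1)` and `waveLp n`. -/
theorem integral_f_mul_inner_waveLp (G : Lp ℂ 2 (volume : Measure ℝ)) (n : ℕ) (t : ℝ) :
    ∫ s, (f (n + 1) (t - s) : ℂ) * inner ℂ G (waveLp n s) = inner ℂ G (waveLp (n + 1) t) := by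
  have hGi : Integrable fun v => ‖G v‖ * ‖H n v‖ :=
    (Lp.memLp G).norm.integrable_mul (memLp_H n).norm
  have hfm := (integrable_f (n + 1) t).norm
  have hw : Continuous fun p : ℝ × ℝ => transferWave n p.1 p.2 :=
    ((continuous_H n).comp continuous_snd).mul (by fun_prop)
  have hint : Integrable (Function.uncurry fun s v =>
      (f (n + 1) (t - s) : ℂ) * (conj (G v) * transferWave n s v))
      ((volume : Measure ℝ).prod volume) := by
    refine (hfm.mul_prod hGi).mono' ?_ (ae_of_all _ fun p => ?_)
    · have h1 : AEStronglyMeasurable (fun p : ℝ × ℝ => (f (n + 1) (t - p.1) : ℂ))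
          ((volume : Measure ℝ).prod volume) :=
        (integrable_f (n + 1) t).ofReal.aestronglyMeasurable.comp_fst
      have h2 : AEStronglyMeasurable (fun p : ℝ × ℝ => conj (G p.2))
          ((volume : Measure ℝ).prod volume) :=
        (Complex.continuous_conj.comp_aestronglyMeasurable (Lp.memLp G).1).comp_snd
      exact h1.mul (h2.mul hw.aestronglyMeasurable)
    · simp only [Function.uncurry, norm_mul, RCLike.norm_conj, norm_transferWave,
        Complex.norm_real, le_refl]
  simp only [inner_waveLp_right, ← integral_const_mul]
  rw [integral_integral_swap hint]
  refine integral_congr_ae (ae_of_all _ fun v => ?_)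
  simp only [← integral_f_mul_transferWave]
  rw [← integral_const_mul]
  refine integral_congr_ae (ae_of_all _ fun s => ?_)
  simp only
  ring

variable [IsProbabilityMeasure P]

/-- An operator that sends the waves of order `0` to `2π X 0 t` sends those of order `n` to
`2π X n t`, as both sides satisfy the same convolution recursion. -/
theorem clm_waveLp_ae_eq (hm : ∀ t, Measurable (B t)) (hc : ∀ ω, Continuous fun t => B t ω)
    (J : Lp ℂ 2 (volume : Measure ℝ) →L[ℂ] Lp ℂ 2 P)
    (hJ : ∀ t, J (waveLp 0 t) =ᵐ[P] fun ω => ((2 * Real.pi * X B 0 t ω : ℝ) : ℂ))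
    (n : ℕ) (t : ℝ) : J (waveLp n t) =ᵐ[P] fun ω => ((2 * Real.pi * X B n t ω : ℝ) : ℂ) := by
  induction n generalizing t with
  | zero => exact hJ t
  | succ n ih =>
    set F : ℝ → Ω → ℂ := fun s ω =>
      (f (n + 1) (t - s) : ℂ) * ((2 * Real.pi * X B n s ω : ℝ) : ℂ)
    have hFm : AEStronglyMeasurable (Function.uncurry F) ((volume : Measure ℝ).prod P) := by
      have h1 : AEStronglyMeasurable (fun p : ℝ × Ω => (f (n + 1) (t - p.1) : ℂ))
          ((volume : Measure ℝ).prod P) :=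
        (integrable_f (n + 1) t).ofReal.aestronglyMeasurable.comp_fst
      have h2 : Measurable (fun p : ℝ × Ω => ((2 * Real.pi * X B n p.1 p.2 : ℝ) : ℂ)) :=
        Complex.measurable_ofReal.comp ((measurable_uncurry_X hm hc n).const_mul _)
      exact h1.mul h2.aestronglyMeasurable
    have hXi : ∀ s, Integrable (fun ω => ((2 * Real.pi * X B n s ω : ℝ) : ℂ)) P := fun s =>
      ((Lp.memLp (J (waveLp n s))).integrable (by norm_num)).congr (ih s)
    have hFi : Integrable (Function.uncurry F) ((volume : Measure ℝ).prod P) := by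
      rw [integrable_prod_iff hFm]
      refine ⟨ae_of_all _ fun s =>
        (hXi s).const_mul (f (n + 1) (t - s) : ℂ), ?_⟩
      refine ((integrable_f (n + 1) t).norm.mul_const (‖J‖ * ‖waveLp n 0‖)).mono'
        hFm.norm.integral_prod_right' (ae_of_all _ fun s => ?_)
      rw [Real.norm_of_nonneg (integral_nonneg fun ω => norm_nonneg _)]
      simp only [Function.uncurry, F, norm_mul, Complex.norm_real]
      rw [integral_const_mul]
      gcongr
      rw [← norm_waveLp n s]
      refine le_trans (le_of_eq ?_) ((integral_norm_le_norm_lp _).trans (J.le_opNorm _))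
      refine integral_congr_ae ?_
      filter_upwards [ih s] with ω hω
      rw [hω, Complex.norm_real, norm_mul, norm_mul]
    have hXF : ∀ ω, ((2 * Real.pi * X B (n + 1) t ω : ℝ) : ℂ) = ∫ s, F s ω := by
      intro ω
      rw [(integrable_and_X_succ_eq (hc ω) n t).2, ← integral_const_mul, ← integral_complex_ofReal]
      refine integral_congr_ae (ae_of_all _ fun s => ?_)
      simp only [F]
      push_cast
      ring
    have hint : Integrable (fun ω => ((2 * Real.pi * X B (n + 1) t ω : ℝ) : ℂ)) P := by
      simp only [hXF]
      exact hFi.integral_prod_right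
    refine Integrable.ae_eq_of_forall_setIntegral_eq _ _
      ((Lp.memLp (J (waveLp (n + 1) t))).integrable (by norm_num)) hint fun A hA _ => ?_
    -- the functional `ψ ↦ ∫_A J ψ` of `L²(ℝ)` is the inner product with `G`
    set G := ContinuousLinearMap.adjoint J (indicatorConstLp 2 hA (measure_ne_top P A) 1)
    have hG : ∀ ψ, ∫ ω in A, J ψ ω ∂P = inner ℂ G ψ := by
      intro ψ
      rw [ContinuousLinearMap.adjoint_inner_left, L2.inner_indicatorConstLp_one]
    have hFA : Integrable (Function.uncurry fun ω s => F s ω)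
        ((P.restrict A).prod (volume : Measure ℝ)) := by
      have h1 : Integrable (Function.uncurry F) ((volume : Measure ℝ).prod (P.restrict A)) := by
        have h2 := hFi.restrict (s := Set.univ ×ˢ A)
        rwa [← Measure.prod_restrict, Measure.restrict_univ] at h2
      exact h1.swap
    rw [hG, ← integral_f_mul_inner_waveLp]
    simp only [hXF]
    rw [integral_integral_swap hFA]
    refine integral_congr_ae (ae_of_all _ fun s => ?_)
    simp only [F]
    rw [integral_const_mul, ← hG]
    congr 1
    exact integral_congr_ae (ae_restrict_of_ae (ih s))

/-- The operator `g ↦ ∫ g(v) ζ(dv)`: up to the factor `√(2π)` an isometry from `L²(ℝ)` to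
`L²(P)`, with values that are centered and jointly Gaussian, which sends the wave `waveLp n t` to
`2π X n t`. -/
theorem exists_spectral_operator (hB : IsPreBrownianReal B P) (hm : ∀ t, Measurable (B t))
    (hc : ∀ ω, Continuous fun t => B t ω) :
    ∃ J : Lp ℂ 2 (volume : Measure ℝ) →L[ℂ] Lp ℂ 2 P,
      (∀ x y, inner ℂ (J x) (J y) = ((2 * Real.pi : ℝ) : ℂ) * inner ℂ x y) ∧
      IsGaussianProcess (fun (g : Lp ℂ 2 (volume : Measure ℝ)) ω => J g ω) P ∧
      (∀ g, ∫ ω, J g ω ∂P = 0) ∧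
      ∀ n t, J (waveLp n t) =ᵐ[P] fun ω => ((2 * Real.pi * X B n t ω : ℝ) : ℂ) := by
  have hZ := isGaussianProcess_X_zero hB
  have hZ0 : ∀ t, ∫ ω, 2 * Real.pi * X B 0 t ω ∂P = 0 := fun t => by
    rw [integral_const_mul, integral_X_zero hB, mul_zero]
  have hmem : ∀ t, MemLp (fun ω => ((2 * Real.pi * X B 0 t ω : ℝ) : ℂ)) 2 P :=
    fun t => (hZ.hasGaussianLaw_eval t).memLp_two.ofReal
  have hgram : ∀ s t, inner ℂ ((hmem s).toLp _) ((hmem t).toLp _)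
      = ((2 * Real.pi : ℝ) : ℂ) * inner ℂ (waveLp 0 s) (waveLp 0 t) := by
    intro s t
    have h1 : cov[fun ω => 2 * Real.pi * X B 0 s ω, fun ω => 2 * Real.pi * X B 0 t ω; P] =
        ∫ ω, (2 * Real.pi * X B 0 s ω) * (2 * Real.pi * X B 0 t ω) ∂P := by
      rw [covariance_eq_sub (hZ.hasGaussianLaw_eval s).memLp_two
        (hZ.hasGaussianLaw_eval t).memLp_two, hZ0, zero_mul, sub_zero]
      rfl
    rw [covariance_const_mul_left, covariance_const_mul_right] at h1
    have h2 : cov[fun ω => X B 0 s ω, fun ω => X B 0 t ω; P] = Real.exp (-|t - s| / 2) :=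
      covariance_X_zero hB s t
    rw [h2] at h1
    rw [inner_waveLp_zero, L2.inner_def]
    have h3 : ∫ ω, inner ℂ ((hmem s).toLp _ ω) ((hmem t).toLp _ ω) ∂P =
        ∫ ω, (((2 * Real.pi * X B 0 s ω) * (2 * Real.pi * X B 0 t ω) : ℝ) : ℂ) ∂P := by
      refine integral_congr_ae ?_
      filter_upwards [(hmem s).coeFn_toLp, (hmem t).coeFn_toLp] with ω h4 h5
      rw [h4, h5, RCLike.inner_apply, Complex.conj_ofReal]
      push_cast
      ring
    rw [h3, integral_complex_ofReal, ← h1]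
    push_cast
    ring
  obtain ⟨J, hJe, hJ⟩ := exists_clm_of_gram (waveLp 0) (fun t => (hmem t).toLp _) (2 * Real.pi)
    (by positivity) hgram span_waveLp_zero_dense
  have hJ0 : ∀ t, J (waveLp 0 t) =ᵐ[P] fun ω => ((2 * Real.pi * X B 0 t ω : ℝ) : ℂ) := by
    intro t
    rw [hJe]
    exact (hmem t).coeFn_toLp
  refine ⟨J, hJ, isGaussianProcess_clm J hZ hZ0 hJ0 span_waveLp_zero_dense,
    fun g => (integral_re_eq_zero_and_charFun J hZ hZ0 hJ0 span_waveLp_zero_dense g).1,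
    clm_waveLp_ae_eq hm hc J hJ0⟩

end Representation

end IntegratedBM

end

theorem proposition3p1 {Ω : Type*} [MeasurableSpace Ω] (P : Measure Ω) [IsProbabilityMeasure P]
    (B : ℝ≥0 → Ω → ℝ) (hB : IsBrownianReal B P) :
    -- joint Gaussianity of the whole collection of variables `X n t`
    IsGaussianProcess (fun (p : ℕ × ℝ) ω => IntegratedBM.X B p.1 p.2 ω) P ∧
    -- joint stationarity
    IntegratedBM.JointlyStationary (IntegratedBM.X B) P ∧
    -- almost every path of `X n`, for `n ≥ 1`, is the convolution of `f n` and that of `X (n - 1)`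
    (∀ᵐ ω ∂P, ∀ (n : ℕ), 1 ≤ n → ∀ t : ℝ,
      Integrable (fun s => IntegratedBM.f n (t - s) * IntegratedBM.X B (n - 1) s ω) volume ∧
      IntegratedBM.X B n t ω =
        ∫ s, IntegratedBM.f n (t - s) * IntegratedBM.X B (n - 1) s ω) ∧
    -- spectral representation, with one random measure for all `n` and `t`
    (∃ ζ : Set ℝ → Ω → ℂ, IntegratedBM.IsSpectralNoise ζ P ∧
      ∀ (n : ℕ) (t : ℝ), ∃ Y : Ω → ℂ,
        IntegratedBM.HasStochIntegral ζ P
          (fun v => IntegratedBM.H n v * Complex.exp (Complex.I * v * t)) Y ∧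
        ∀ᵐ ω ∂P, (IntegratedBM.X B n t ω : ℂ) = 1 / (2 * Real.pi) * Y ω) := by
  open IntegratedBM in
  obtain ⟨B', hm, hc, hBB'⟩ := exists_measurable_continuous_version
    (fun t => hB.toIsPreBrownianReal.aemeasurable t) hB.cont
  have hB' : IsPreBrownianReal B' P := hB.toIsPreBrownianReal.congr fun t => by
    filter_upwards [hBB'] with ω hω using hω t
  obtain ⟨J, hJ, hG, h0, hJX⟩ := exists_spectral_operator hB' hm hc
  have hX : ∀ n t, ∀ᵐ ω ∂P, (X B n t ω : ℂ) = 1 / (2 * Real.pi) * J (waveLp n t) ω := by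
    intro n t
    filter_upwards [hBB', hJX n t] with ω h1 h2
    rw [X_congr h1, h2]
    push_cast
    field_simp
  have hXre : ∀ p : ℕ × ℝ, (fun ω => (2 * Real.pi)⁻¹ * (J (waveLp p.1 p.2) ω).re) =ᵐ[P]
      X B p.1 p.2 := by
    intro p
    filter_upwards [hX p.1 p.2] with ω hω
    have h1 := congrArg Complex.re hω
    rw [Complex.ofReal_re, one_div, show (2 * Real.pi : ℂ)⁻¹ = (((2 * Real.pi)⁻¹ : ℝ) : ℂ) by
      push_cast; rfl, Complex.re_ofReal_mul] at h1
    exact h1.symm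
  have hgauss : IsGaussianProcess (fun (p : ℕ × ℝ) ω => X B p.1 p.2 ω) P := by
    have h1 := hG.comp_right fun p : ℕ × ℝ => waveLp p.1 p.2
    exact (h1.comp_left fun _ => (2 * Real.pi)⁻¹ • Complex.reCLM).congr hXre
  have hmean : ∀ p : ℕ × ℝ, ∫ ω, X B p.1 p.2 ω ∂P = 0 := by
    intro p
    have h1 : ∫ ω, (X B p.1 p.2 ω : ℂ) ∂P = 0 := by
      rw [integral_congr_ae (hX p.1 p.2), integral_const_mul, h0, mul_zero]
    rw [integral_complex_ofReal] at h1
    exact_mod_cast h1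
  have hcov : ∀ p q : ℕ × ℝ, ((cov[X B p.1 p.2, X B q.1 q.2; P] : ℝ) : ℂ) =
      (2 * Real.pi)⁻¹ * inner ℂ (waveLp p.1 p.2) (waveLp q.1 q.2) := by
    intro p q
    rw [covariance_eq_sub (hgauss.hasGaussianLaw_eval p).memLp_two
      (hgauss.hasGaussianLaw_eval q).memLp_two, hmean, zero_mul, sub_zero,
      ← integral_complex_ofReal]
    have h1 := hJ (waveLp p.1 p.2) (waveLp q.1 q.2)
    rw [L2.inner_def] at h1
    have h2 : ∫ ω, ((X B p.1 p.2 * X B q.1 q.2) ω : ℂ) ∂P = (2 * Real.pi)⁻¹ * (2 * Real.pi)⁻¹ *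
        ∫ ω, inner ℂ (J (waveLp p.1 p.2) ω) (J (waveLp q.1 q.2) ω) ∂P := by
      rw [← integral_const_mul]
      refine integral_congr_ae ?_
      filter_upwards [hX p.1 p.2, hX q.1 q.2] with ω h3 h4
      have h5 : conj (X B p.1 p.2 ω : ℂ) = X B p.1 p.2 ω := Complex.conj_ofReal _
      rw [Pi.mul_apply, Complex.ofReal_mul, ← h5, h3, h4, RCLike.inner_apply]
      simp [map_ofNat]
      ring
    rw [h2, h1]
    push_cast
    field_simp
  refine ⟨hgauss, ?_, ?_, noise J, isSpectralNoise_noise J hJ hG h0, fun n t =>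
    ⟨_, hasStochIntegral_noise J (memLp_transferWave n t), hX n t⟩⟩
  · intro h I
    refine identDistrib_restrict_of_covariance_eq hgauss
      (hgauss.comp_right fun p : ℕ × ℝ => (p.1, p.2 + h)) (fun p => ?_) (fun p q => ?_) I
    · rw [hmean p]
      exact (hmean (p.1, p.2 + h)).symm
    · apply Complex.ofReal_injective
      have h1 := hcov (p.1, p.2 + h) (q.1, q.2 + h)
      simp only [inner_waveLp_shift] at h1
      exact (hcov p q).trans h1.symm
  · filter_upwards [hB.cont] with ω hω n hn t
    obtain ⟨m, rfl⟩ : ∃ m, n = m + 1 := ⟨n - 1, by omega⟩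
    exact integrable_and_X_succ_eq hω m t
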